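/- Let $H$ be a real Hilbert space with an orthonormal basis $(e_n)_{n\in\mathbb N}$, let $S=(S(t))_{t\ge 0}$ be a $C_0$-semigroup on $H$ with infinitesimal generator $A$, and let $A^*$ be the adjoint of $A$. Let $(\beta_n)$ be a sequence of positive real numbers, and let $L^n$, $n\in\mathbb N$, be independent, identically distributed, càdlàg, real-valued Lévy processes on a probability space, whose common jump intensity measure $$\nu(B)=\mathbb E\,\#\{s\in(0,1]:\ \Delta L^n(s)\neq 0,\ \Delta L^n(s)\in B\},\qquad B\subseteq\mathbb R \text{ Borel},$$ is not identically zero. Put $L(t)=\sum_n\beta_nL^n(t)e_n$ (a cylindrical process, which need not take values in $H$), and let $X$ be an $H$-valued process with $$X(t)=\int_0^tS(t-s)\,dL(s),\qquad t\ge 0;$$ this means that every $X(t)$ is an $H$-valued random variable and that, for all $t\ge0$ and all $k$, $$\langle X(t),e_k\rangle=\sum_n\beta_n\int_0^t\langle S(t-s)e_n,e_k\rangle\,dL^n(s)\quad\text{almost surely},$$ where the series converges in probability and the integrals of deterministic continuous functions with respect to $L^n$ are limits in probability of Riemann sums. Assume that $e_n\in D(A^*)$ for every $n$ and that $\beta_n$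 does not converge to $0$. Then, almost surely, there is no $t>0$ at which the trajectory of $X$ has a left limit $X(t-)$ in the norm of $H$, and no $t\ge 0$ at which it has a right limit $X(t+)$ in the norm of $H$. -/

import Mathlib

open Filter Topology MeasureTheory ProbabilityTheory
open scoped NNReal ENNReal InnerProductSpace LinearPMap

/-- A `C₀`-semigroup (strongly continuous one-parameter semigroup) of bounded linear operators
on a real Hilbert space `H`. -/
structure C0Semigroup (H : Type*) [NormedAddCommGroup H] [InnerProductSpace ℝ H] where
  /-- the operator `S(t)` -/
  op : ℝ≥0 → H →L[ℝ] H
  op_zero : op 0 = ContinuousLinearMap.id ℝ H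
  op_add : ∀ s t : ℝ≥0, op (s + t) = (op s).comp (op t)
  continuous_orbit : ∀ x : H, Continuous fun t : ℝ≥0 => op t x

namespace C0Semigroup

variable {H : Type*} [NormedAddCommGroup H] [InnerProductSpace ℝ H]

/-- The difference quotient `(S(h) x - x) / h`. -/
noncomputable def diffQuot (S : C0Semigroup H) (x : H) (h : ℝ≥0) : H :=
  (h : ℝ)⁻¹ • (S.op h x - x)

/-- `y = A x`, where `A` is the infinitesimal generator: `(S(h) x - x) / h → y` as `h ↓ 0`. -/
def HasGenerator (S : C0Semigroup H) (x y : H) : Prop :=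
  Tendsto (S.diffQuot x) (𝓝[>] (0 : ℝ≥0)) (𝓝 y)

theorem HasGenerator.add {S : C0Semigroup H} {x x' y y' : H}
    (h : S.HasGenerator x y) (h' : S.HasGenerator x' y') :
    S.HasGenerator (x + x') (y + y') := by
  refine (Tendsto.add h h').congr fun r => ?_
  simp only [diffQuot, map_add, ← smul_add]
  congr 1
  abel

theorem HasGenerator.smul {S : C0Semigroup H} {x y : H} (c : ℝ) (h : S.HasGenerator x y) :
    S.HasGenerator (c • x) (c • y) := by
  refine (Tendsto.const_smul h c).congr fun r => ?_
  simp only [diffQuot, map_smul, ← smul_sub]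
  rw [smul_comm]

theorem HasGenerator.unique {S : C0Semigroup H} {x y y' : H}
    (h : S.HasGenerator x y) (h' : S.HasGenerator x y') : y = y' :=
  tendsto_nhds_unique h h'

/-- The infinitesimal generator `A` of the semigroup, as a partially defined operator: `D(A)` is
the set of all `x` for which `(S(h) x - x) / h` converges in `H` as `h ↓ 0`, and `A x` is the
limit. -/
noncomputable def generator (S : C0Semigroup H) : H →ₗ.[ℝ] H where
  domain :=
    { carrier := {x | ∃ y, S.HasGenerator x y}
      add_mem' := fun ⟨_, h⟩ ⟨_, h'⟩ => ⟨_, h.add h'⟩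
      zero_mem' := ⟨0, by
        have : S.diffQuot 0 = fun _ => 0 := by
          funext r
          simp [diffQuot]
        rw [HasGenerator, this]
        exact tendsto_const_nhds⟩
      smul_mem' := fun c _ ⟨_, h⟩ => ⟨_, h.smul c⟩ }
  toFun :=
    { toFun := fun x => Classical.choose x.2
      map_add' := fun x x' =>
        (Classical.choose_spec (x + x').2).unique
          ((Classical.choose_spec x.2).add (Classical.choose_spec x'.2))
      map_smul' := fun c x =>
        (Classical.choose_spec (c • x).2).unique ((Classical.choose_spec x.2).smul c) }

theorem generator_spec (S : C0Semigroup H) (x : S.generator.domain) :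
    S.HasGenerator (x : H) (S.generator x) :=
  Classical.choose_spec x.2

end C0Semigroup

/-- A path `[0, ∞) → ℝ` is càdlàg: right continuous at every time, with a (finite) left limit at
every positive time. -/
def IsCadlagPath (f : ℝ≥0 → ℝ) : Prop :=
  (∀ t, Tendsto f (𝓝[>] t) (𝓝 (f t))) ∧ ∀ t, 0 < t → ∃ l, Tendsto f (𝓝[<] t) (𝓝 l)

/-- A real-valued Lévy process with (almost surely) càdlàg trajectories. Stochastic continuity is
not listed because it follows from right continuity and stationarity of the increments. -/
structure IsLevyProcess {Ω : Type*} [MeasurableSpace Ω] (P : Measure Ω) (Y : ℝ≥0 → Ω → ℝ) :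
    Prop where
  measurable : ∀ t, Measurable (Y t)
  zero : ∀ᵐ ω ∂P, Y 0 ω = 0
  indep : HasIndepIncrements Y P
  stationary : ∀ s t : ℝ≥0, IdentDistrib (fun ω => Y (s + t) ω - Y s ω) (Y t) P P
  cadlag : ∀ᵐ ω ∂P, IsCadlagPath fun t => Y t ω

/-- The jump `f(t) - f(t-)` of a path at time `t`. -/
noncomputable def pathJump (f : ℝ≥0 → ℝ) (t : ℝ≥0) : ℝ :=
  f t - Function.leftLim f t

/-- The jump intensity measure of a real Lévy process, evaluated on a Borel set `B`:
`ν(B)` is the expected number of times `s ∈ (0, 1]` with `ΔY(s) ≠ 0` and `ΔY(s) ∈ B`. -/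
noncomputable def jumpIntensity {Ω : Type*} [MeasurableSpace Ω] (P : Measure Ω)
    (Y : ℝ≥0 → Ω → ℝ) (B : Set ℝ) : ℝ≥0∞ :=
  ∫⁻ ω, ({s : ℝ≥0 | 0 < s ∧ s ≤ 1 ∧ pathJump (fun t => Y t ω) s ≠ 0 ∧
    pathJump (fun t => Y t ω) s ∈ B}.encard : ℝ≥0∞) ∂P

/-- `I = ∫_0^t f(s) dY(s)` for a deterministic continuous integrand `f`: `I` is the limit in
probability of the Riemann sums `∑_k f(kt/N) (Y((k+1)t/N) - Y(kt/N))`. It is unique up to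
almost sure equality. -/
def IsStochIntegral {Ω : Type*} [MeasurableSpace Ω] (P : Measure Ω) (f : ℝ≥0 → ℝ)
    (Y : ℝ≥0 → Ω → ℝ) (t : ℝ≥0) (I : Ω → ℝ) : Prop :=
  TendstoInMeasure P
    (fun (N : ℕ) (ω : Ω) => ∑ k ∈ Finset.range N,
      f ((k : ℝ≥0) * t / (N : ℝ≥0)) *
        (Y (((k : ℝ≥0) + 1) * t / (N : ℝ≥0)) ω - Y ((k : ℝ≥0) * t / (N : ℝ≥0)) ω))
    atTop I

/-- `X` is an `H`-valued process with `X(t) = ∫_0^t S(t-s) dL(s)`, where `L` is the (cylindrical)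
process `L(t) = ∑_n β_n L^n(t) e_n`, which need not take values in `H`: every `X(t)` is an
`H`-valued random variable, and for all `t` and `k`
`⟨X(t), e_k⟩ = ∑_n β_n ∫_0^t ⟨S(t-s) e_n, e_k⟩ dL^n(s)`,
the series converging in probability. As `(e_k)` is an orthonormal basis, this determines each
`X(t)` up to almost sure equality, i.e. `X` up to modification; it is satisfied as soon as the
series `∑_n β_n ∫_0^t S(t-s) e_n dL^n(s)` converges to `X(t)` weakly or strongly in `H`, in
probability. -/
structure IsStochConvolution {Ω : Type*} [MeasurableSpace Ω] (P : Measure Ω)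
    {H : Type*} [NormedAddCommGroup H] [InnerProductSpace ℝ H]
    (S : C0Semigroup H) (e : HilbertBasis ℕ ℝ H) (β : ℕ → ℝ) (L : ℕ → ℝ≥0 → Ω → ℝ)
    (X : ℝ≥0 → Ω → H) : Prop where
  aestronglyMeasurable : ∀ t, AEStronglyMeasurable (X t) P
  coord : ∀ (t : ℝ≥0) (k : ℕ), ∃ I : ℕ → Ω → ℝ,
    (∀ n, IsStochIntegral P (fun s => ⟪S.op (t - s) (e n), e k⟫_ℝ) (L n) t (I n)) ∧
    TendstoInMeasure P (fun (N : ℕ) (ω : Ω) => ∑ n ∈ Finset.range N, β n * I n ω) atTop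
      (fun ω => ⟪X t ω, e k⟫_ℝ)

/-! The idea is that infinitely many coordinates of `X` oscillate independently, each with a
probability bounded below, so that almost surely at least one does so on every rational interval.

Since `e k` lies in the domain of the adjoint, integration by parts turns the integral against `L n`
into `⟪e n, e k⟫ * L n` plus a convolution with continuous trajectories. Hence, for finite `F`
containing `k`, the coordinate `⟪X, e k⟫` is `β k * L k` plus a continuous term plus a remainder
independent of the `L n` with `n ∈ F` (`exists_coord_decomposition`). The modulus at vanishing scale
ignores the continuous term. The remainder can be frozen by Fubini and becomes a deterministic
shift.

Jumps prevent `L 0` from having small modulus almost surely on any interval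
(`exists_not_ae_hasSmallModulus`), and symmetrization upgrades this to a bound `q < 1` valid for all
shifts (`exists_bound_shift_hasSmallModulus`). If `X` oscillates little in norm, so do all its
coordinates; over `N` indices with `c ≤ β k` this has probability at most `q ^ N`, which tends to
`0` (`ae_exists_lt_norm_sub`).

Only rational times enter: the identities for `X t` hold almost surely for each fixed `t`, so they
can be used simultaneously only at countably many times. -/

theorem NNReal.tendsto_coe_nhdsGT_zero :
    Tendsto (fun r : ℝ≥0 => (r : ℝ)) (𝓝[>] (0 : ℝ≥0)) (𝓝[≠] (0 : ℝ)) := by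
  refine tendsto_nhdsWithin_of_tendsto_nhds_of_eventually_within _ ?_ ?_
  · exact (NNReal.continuous_coe.tendsto' 0 0 rfl).mono_left nhdsWithin_le_nhds
  · filter_upwards [self_mem_nhdsWithin] with r hr
    exact (NNReal.coe_pos.2 hr).ne'

/-! ### Orbits of the semigroup tested against the domain of the adjoint -/

namespace C0Semigroup

variable {H : Type*} [NormedAddCommGroup H] [InnerProductSpace ℝ H]

theorem continuous_orbit_toNNReal (S : C0Semigroup H) (x : H) :
    Continuous fun u : ℝ => S.op u.toNNReal x :=
  (S.continuous_orbit x).comp continuous_real_toNNReal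

/-- Orbit integrals lie in the domain of the generator. -/
theorem hasGenerator_integral [CompleteSpace H] (S : C0Semigroup H) (x : H) (t : ℝ≥0) :
    S.HasGenerator (∫ u in (0 : ℝ)..t, S.op u.toNNReal x) (S.op t x - x) := by
  have hc := S.continuous_orbit_toNNReal x
  set G : ℝ → H := fun r => ∫ u in (0 : ℝ)..r, S.op u.toNNReal x with hG
  have hd : ∀ r, HasDerivAt G (S.op r.toNNReal x) r := fun r =>
    (hc.integral_hasStrictDerivAt 0 r).hasDerivAt
  have h1 := (hasDerivAt_iff_tendsto_slope_zero.1 (hd t)).comp NNReal.tendsto_coe_nhdsGT_zero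
  have h2 := (hasDerivAt_iff_tendsto_slope_zero.1 (hd 0)).comp NNReal.tendsto_coe_nhdsGT_zero
  have h3 := h1.sub h2
  simp only [Real.toNNReal_coe, Real.toNNReal_zero, S.op_zero, ContinuousLinearMap.id_apply] at h3
  refine h3.congr fun r => ?_
  simp only [Function.comp, diffQuot, ← smul_sub, zero_add]
  congr 1
  have hG0 : G 0 = 0 := by simp [hG]
  -- By the semigroup law, the quotient of `G t` is the difference of the quotients of `G` at `t`
  -- and at `0`.
  have hshift : S.op r (G t) = G (t + r) - G r := by
    have e1 : S.op r (G t) = ∫ u in (0 : ℝ)..t, S.op (u + r).toNNReal x := by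
      simp only [hG]
      rw [← ContinuousLinearMap.intervalIntegral_comp_comm _ (hc.intervalIntegrable _ _)]
      refine intervalIntegral.integral_congr fun u hu => ?_
      rw [Set.uIcc_of_le t.coe_nonneg] at hu
      have : (u + r).toNNReal = r + u.toNNReal := by
        rw [Real.toNNReal_add hu.1 r.coe_nonneg, Real.toNNReal_coe, add_comm]
      simp only [this, S.op_add, ContinuousLinearMap.comp_apply]
    rw [e1, intervalIntegral.integral_comp_add_right (fun u => S.op u.toNNReal x) (r : ℝ),
      zero_add, hG]
    exact (intervalIntegral.integral_interval_sub_left (hc.intervalIntegrable _ _)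
      (hc.intervalIntegrable _ _)).symm
  rw [hshift, hG0]
  abel

/-- Weak form of `d/dt ⟪S(t) x, v⟫ = ⟪S(t) x, A* v⟫`. -/
theorem exists_inner_eq_add_integral [CompleteSpace H] (S : C0Semigroup H) {v : H}
    (hv : v ∈ (S.generator†).domain) :
    ∃ z : H, ∀ (x : H) (t : ℝ≥0),
      ⟪S.op t x, v⟫_ℝ = ⟪x, v⟫_ℝ + ∫ u in (0 : ℝ)..t, ⟪S.op u.toNNReal x, z⟫_ℝ := by
  rw [LinearPMap.mem_adjoint_domain_iff] at hv
  -- Hahn–Banach extends the bounded functional to all of `H`, so density of the generator's domain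
  -- is not needed; Riesz then gives `z`.
  obtain ⟨g, hg, -⟩ := exists_extension_norm_eq S.generator.domain
    (⟨(innerₛₗ ℝ v) ∘ₗ S.generator.toFun, hv⟩ : S.generator.domain →L[ℝ] ℝ)
  refine ⟨(InnerProductSpace.toDual ℝ H).symm g, fun x t => ?_⟩
  have hx := S.hasGenerator_integral x t
  have h1 := hg ⟨_, _, hx⟩
  have h2 : S.generator ⟨_, _, hx⟩ = S.op t x - x := (S.generator_spec ⟨_, _, hx⟩).unique hx
  have h3 : g (∫ u in (0 : ℝ)..t, S.op u.toNNReal x) = ⟪v, S.op t x - x⟫_ℝ := by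
    rw [← h2]; exact h1
  rw [← ContinuousLinearMap.intervalIntegral_comp_comm _
    ((S.continuous_orbit_toNNReal x).intervalIntegrable _ _), inner_sub_right] at h3
  have h4 : ∀ w : H, ⟪w, (InnerProductSpace.toDual ℝ H).symm g⟫_ℝ = g w := fun w => by
    rw [real_inner_comm, InnerProductSpace.toDual_symm_apply]
  simp only [h4]
  rw [h3, real_inner_comm (S.op t x) v, real_inner_comm x v]
  ring

end C0Semigroup

/-! ### Grid approximation from the right -/

/-- The smallest point of the grid `t / N * ℕ` that is at least `s`. -/
noncomputable def gridCeil (t : ℝ≥0) (N : ℕ) (s : ℝ≥0) : ℝ≥0 :=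
  (⌈s * N / t⌉₊ : ℝ≥0) * t / N

theorem le_gridCeil {t : ℝ≥0} (ht : 0 < t) {N : ℕ} (hN : 0 < N) (s : ℝ≥0) :
    s ≤ gridCeil t N s := by
  have hN' : (0 : ℝ≥0) < N := by exact_mod_cast hN
  rw [gridCeil, le_div_iff₀ hN', ← div_le_iff₀ ht]
  exact Nat.le_ceil _

theorem gridCeil_le {t : ℝ≥0} (ht : 0 < t) {N : ℕ} (hN : 0 < N) (s : ℝ≥0) :
    gridCeil t N s ≤ s + t / N := by
  have hN' : (0 : ℝ≥0) < N := by exact_mod_cast hN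
  have h := (Nat.ceil_lt_add_one (zero_le (a := s * N / t))).le
  rw [gridCeil, div_le_iff₀ hN', add_mul, div_mul_cancel₀ _ hN'.ne']
  calc (⌈s * N / t⌉₊ : ℝ≥0) * t ≤ (s * N / t + 1) * t := by gcongr
    _ = s * N + t := by rw [add_mul, div_mul_cancel₀ _ ht.ne', one_mul]

theorem tendsto_gridCeil {t : ℝ≥0} (ht : 0 < t) (s : ℝ≥0) :
    Tendsto (fun N => gridCeil t N s) atTop (𝓝[≥] s) := by
  refine tendsto_nhdsWithin_of_tendsto_nhds_of_eventually_within _ ?_ ?_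
  · have h : Tendsto (fun N : ℕ => s + t / (N : ℝ≥0)) atTop (𝓝 s) := by
      have := (tendsto_const_div_atTop_nhds_zero_nat (t : ℝ))
      have h2 : Tendsto (fun N : ℕ => t / (N : ℝ≥0)) atTop (𝓝 0) := by
        rw [← NNReal.tendsto_coe]; simpa using this
      simpa using tendsto_const_nhds.add h2
    refine tendsto_of_tendsto_of_tendsto_of_le_of_le' tendsto_const_nhds h ?_ ?_
    · filter_upwards [eventually_gt_atTop 0] with N hN using le_gridCeil ht hN s
    · filter_upwards [eventually_gt_atTop 0] with N hN using gridCeil_le ht hN s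
  · filter_upwards [eventually_gt_atTop 0] with N hN using le_gridCeil ht hN s

theorem measurable_comp_gridCeil (Y : ℝ≥0 → ℝ) (t : ℝ≥0) (N : ℕ) :
    Measurable fun s : ℝ => Y (gridCeil t N s.toNNReal) := by
  have h1 : Measurable fun s : ℝ => ⌈s.toNNReal * N / t⌉₊ :=
    Nat.measurable_ceil.comp ((measurable_real_toNNReal.mul_const _).div_const _)
  exact (measurable_from_nat (f := fun k : ℕ => Y ((k : ℝ≥0) * t / N))).comp h1

theorem sum_mul_sub_by_parts (f y : ℕ → ℝ) (N : ℕ) :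
    ∑ k ∈ Finset.range N, f k * (y (k + 1) - y k) =
      f N * y N - f 0 * y 0 - ∑ k ∈ Finset.range N, (f (k + 1) - f k) * y (k + 1) := by
  induction N with
  | zero => simp
  | succ n ih => rw [Finset.sum_range_succ, Finset.sum_range_succ, ih]; ring

/-! ### Càdlàg paths: boundedness, convolution, integration by parts -/

namespace IsCadlagPath

variable {Y : ℝ≥0 → ℝ}

theorem tendsto_nhdsGE (hY : IsCadlagPath Y) (t : ℝ≥0) : Tendsto Y (𝓝[≥] t) (𝓝 (Y t)) := by
  have := continuousWithinAt_Ioi_iff_Ici.1 (hY.1 t)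
  exact this

theorem exists_bound (hY : IsCadlagPath Y) (T : ℝ≥0) : ∃ M : ℝ, 0 ≤ M ∧ ∀ s ≤ T, |Y s| ≤ M := by
  have hbd : ∀ {l : Filter ℝ≥0} {a : ℝ}, Tendsto Y l (𝓝 a) → ∀ᶠ s in l, |Y s| ≤ |a| + 1 := by
    intro l a h
    exact (h.abs.eventually (gt_mem_nhds (lt_add_one |a|))).mono fun s hs => hs.le
  have hloc : ∀ t, ∃ M, ∀ᶠ s in 𝓝 t, |Y s| ≤ M := by
    intro t
    have hR := hbd (hY.tendsto_nhdsGE t)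
    have hLt : ∃ M, ∀ᶠ s in 𝓝[<] t, |Y s| ≤ M := by
      rcases eq_or_lt_of_le (zero_le (a := t)) with h | h
      · subst h
        exact ⟨0, by simp⟩
      · obtain ⟨l, hl⟩ := hY.2 t h
        exact ⟨_, hbd hl⟩
    obtain ⟨M, hM⟩ := hLt
    refine ⟨max M (|Y t| + 1), ?_⟩
    rw [← nhdsLT_sup_nhdsGE, eventually_sup]
    exact ⟨hM.mono fun s hs => hs.trans (le_max_left _ _),
      hR.mono fun s hs => hs.trans (le_max_right _ _)⟩
  have hcomp : ∃ M : ℝ, ∀ s ∈ Set.Icc 0 T, |Y s| ≤ M := by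
    refine isCompact_Icc.induction_on (p := fun A => ∃ M : ℝ, ∀ s ∈ A, |Y s| ≤ M)
      ⟨0, by simp⟩ ?_ ?_ ?_
    · rintro A B hAB ⟨M, hM⟩
      exact ⟨M, fun s hs => hM s (hAB hs)⟩
    · rintro A B ⟨M, hM⟩ ⟨M', hM'⟩
      refine ⟨max M M', fun s hs => ?_⟩
      rcases hs with hs | hs
      · exact (hM s hs).trans (le_max_left _ _)
      · exact (hM' s hs).trans (le_max_right _ _)
    · intro t _
      obtain ⟨M, hM⟩ := hloc t
      exact ⟨_, mem_nhdsWithin_of_mem_nhds hM, M, fun s hs => hs⟩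
  obtain ⟨M, hM⟩ := hcomp
  exact ⟨M, (abs_nonneg _).trans (hM 0 ⟨le_rfl, zero_le⟩), fun s hs => hM s ⟨zero_le, hs⟩⟩

theorem measurable_comp_toNNReal (hY : IsCadlagPath Y) :
    Measurable fun s : ℝ => Y s.toNNReal := by
  refine measurable_of_tendsto_metrizable (fun N => measurable_comp_gridCeil Y 1 N) ?_
  rw [tendsto_pi_nhds]
  exact fun s => (hY.tendsto_nhdsGE _).comp (tendsto_gridCeil one_pos _)

/-- Convolution of a càdlàg path with a continuous kernel is continuous. -/
theorem continuous_convolution (hY : IsCadlagPath Y) {h : ℝ → ℝ} (hh : Continuous h) :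
    Continuous fun t : ℝ≥0 => ∫ s in (0 : ℝ)..t, h (t - s) * Y s.toNNReal := by
  rw [continuous_iff_continuousAt]
  intro t₀
  set T : ℝ≥0 := t₀ + 1 with hT
  have hlt : ∀ᶠ t in 𝓝 t₀, t ≤ T := (gt_mem_nhds (lt_add_one t₀)).mono fun t ht => le_of_lt ht
  obtain ⟨M, hM0, hM⟩ := hY.exists_bound T
  obtain ⟨K, hK⟩ := (isCompact_Icc (a := (0 : ℝ)) (b := T)).exists_bound_of_continuousOn
    hh.continuousOn
  have hK0 : 0 ≤ K := (norm_nonneg _).trans (hK 0 ⟨le_rfl, T.2⟩)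
  -- An indicator moves the variable endpoint into the integrand, which is then continuous in `t` at
  -- `t₀` except for the single value `s = t₀`; dominated convergence applies.
  have key : ContinuousAt (fun t : ℝ≥0 => ∫ s in (0 : ℝ)..T,
      (Set.Iio (t : ℝ)).indicator (fun s => h (t - s) * Y s.toNNReal) s) t₀ := by
    refine intervalIntegral.continuousAt_of_dominated_interval (bound := fun _ => K * M)
      ?_ ?_ intervalIntegrable_const ?_
    · refine Eventually.of_forall fun t => ?_
      exact ((((hh.comp (continuous_const.sub continuous_id)).measurable.mul
        hY.measurable_comp_toNNReal).indicator measurableSet_Iio)).aestronglyMeasurable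
    · filter_upwards [hlt] with t ht
      refine Eventually.of_forall fun s hs => ?_
      rw [Set.uIoc_of_le T.coe_nonneg] at hs
      by_cases hst : s ∈ Set.Iio (t : ℝ)
      · rw [Set.indicator_of_mem hst, norm_mul]
        have ht' : (t : ℝ) ≤ T := by exact_mod_cast ht
        refine mul_le_mul (hK _ ⟨sub_nonneg.2 (le_of_lt hst), by linarith [hs.1]⟩)
          (hM _ (by simpa using Real.toNNReal_le_toNNReal hs.2)) (norm_nonneg _) hK0
      · rw [Set.indicator_of_notMem hst, norm_zero]
        positivity
    · have : ∀ᵐ s : ℝ, s ≠ t₀ := by simp [ae_iff]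
      filter_upwards [this] with s hs _
      rcases lt_or_gt_of_ne hs with hs | hs
      · have hev : (fun t : ℝ≥0 => h (t - s) * Y s.toNNReal) =ᶠ[𝓝 t₀] fun t =>
            (Set.Iio (t : ℝ)).indicator (fun s => h (t - s) * Y s.toNNReal) s := by
          filter_upwards [NNReal.continuous_coe.continuousAt.eventually (lt_mem_nhds hs)] with t ht
          rw [Set.indicator_of_mem (show s ∈ Set.Iio (t : ℝ) from ht)]
        refine ContinuousAt.congr ?_ hev
        exact ((hh.comp (NNReal.continuous_coe.sub continuous_const)).mul
          continuous_const).continuousAt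
      · have hev : (fun _ : ℝ≥0 => (0 : ℝ)) =ᶠ[𝓝 t₀] fun t =>
            (Set.Iio (t : ℝ)).indicator (fun s => h (t - s) * Y s.toNNReal) s := by
          filter_upwards [NNReal.continuous_coe.continuousAt.eventually (gt_mem_nhds hs)] with t ht
          rw [Set.indicator_of_notMem]
          exact not_lt.2 (le_of_lt ht)
        exact continuousAt_const.congr hev
  refine key.congr ?_
  filter_upwards [hlt] with t ht
  have ht' : (t : ℝ) ≤ T := by exact_mod_cast ht
  rw [intervalIntegral.integral_of_le T.coe_nonneg, intervalIntegral.integral_of_le t.coe_nonneg,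
    setIntegral_indicator measurableSet_Iio, setIntegral_congr_set]
  have h1 : Set.Ioc (0 : ℝ) T ∩ Set.Iio (t : ℝ) = Set.Ioo 0 (t : ℝ) := by
    ext s
    simp only [Set.mem_inter_iff, Set.mem_Ioc, Set.mem_Iio, Set.mem_Ioo]
    exact ⟨fun h => ⟨h.1.1, h.2⟩, fun h => ⟨⟨h.1, h.2.le.trans ht'⟩, h.2⟩⟩
  rw [h1]
  exact Ioo_ae_eq_Ioc

/-- Integration by parts for Riemann sums of a `C¹` integrand against a càdlàg path. -/
theorem tendsto_riemannSum (hY : IsCadlagPath Y) (hY0 : Y 0 = 0) {h : ℝ → ℝ} (hh : Continuous h)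
    (c : ℝ) (t : ℝ≥0) {f : ℝ≥0 → ℝ}
    (hf : ∀ s ≤ t, f s = c + ∫ u in (0 : ℝ)..((t : ℝ) - s), h u) :
    Tendsto (fun N : ℕ => ∑ k ∈ Finset.range N,
        f ((k : ℝ≥0) * t / (N : ℝ≥0)) *
          (Y (((k : ℝ≥0) + 1) * t / (N : ℝ≥0)) - Y ((k : ℝ≥0) * t / (N : ℝ≥0)))) atTop
      (𝓝 (c * Y t + ∫ s in (0 : ℝ)..t, h (t - s) * Y s.toNNReal)) := by
  rcases eq_or_lt_of_le (zero_le (a := t)) with ht | ht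
  · subst ht
    simp [hY0]
  have hlim : Tendsto (fun N : ℕ => ∫ s in (0 : ℝ)..t, h (t - s) * Y (gridCeil t N s.toNNReal))
      atTop (𝓝 (∫ s in (0 : ℝ)..t, h (t - s) * Y s.toNNReal)) := by
    -- `gridCeil` may overshoot `s` by `t / N ≤ t`, hence the bound up to `t + t`.
    obtain ⟨M, hM0, hM⟩ := hY.exists_bound (t + t)
    have hhc : Continuous fun s : ℝ => h (t - s) := hh.comp (continuous_const.sub continuous_id)
    refine intervalIntegral.tendsto_integral_filter_of_dominated_convergence
      (fun s => |h (t - s)| * M) ?_ ?_ ((hhc.abs.mul continuous_const).intervalIntegrable _ _) ?_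
    · exact Eventually.of_forall fun N =>
        (hhc.measurable.mul (measurable_comp_gridCeil Y t N)).aestronglyMeasurable
    · filter_upwards [eventually_gt_atTop 0] with N hN
      refine Eventually.of_forall fun s hs => ?_
      rw [Set.uIoc_of_le t.coe_nonneg] at hs
      rw [norm_mul]
      refine mul_le_mul_of_nonneg_left (hM _ ((gridCeil_le ht hN _).trans ?_)) (abs_nonneg _)
      refine add_le_add (by simpa using Real.toNNReal_le_toNNReal hs.2) ?_
      exact div_le_self (zero_le) (by exact_mod_cast hN)
    · exact Eventually.of_forall fun s _ =>
        ((hY.tendsto_nhdsGE _).comp (tendsto_gridCeil ht _)).const_mul _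
  refine (hlim.const_add (c * Y t)).congr' ?_
  filter_upwards [eventually_gt_atTop 0] with N hN
  have hN' : (0 : ℝ≥0) < N := by exact_mod_cast hN
  have hNR : (0 : ℝ) < N := by exact_mod_cast hN
  have hcast : ∀ k : ℕ, ((k : ℝ≥0) + 1) * t / N = ((k + 1 : ℕ) : ℝ≥0) * t / N := fun k => by
    push_cast; rfl
  simp only [hcast]
  -- Abel summation leaves `Y` at right endpoints; on each cell `gridCeil` equals that endpoint, so
  -- the sum is an exact integral.
  rw [sum_mul_sub_by_parts (fun k => f ((k : ℝ≥0) * t / N)) (fun k => Y ((k : ℝ≥0) * t / N))]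
  have hNt : (N : ℝ≥0) * t / N = t := by rw [mul_comm, mul_div_assoc, div_self hN'.ne', mul_one]
  have hft : f t = c := by rw [hf t le_rfl]; simp
  simp only [hNt, hft, Nat.cast_zero, zero_mul, zero_div, hY0, mul_zero, sub_zero]
  have hle : ∀ k : ℕ, k ≤ N → (k : ℝ≥0) * t / N ≤ t := fun k hk => by
    rw [div_le_iff₀ hN', mul_comm t]
    gcongr
  set a : ℕ → ℝ := fun k => (k : ℝ) * t / N with ha
  have hmono : ∀ k, a k ≤ a (k + 1) := fun k => by
    simp only [ha]; gcongr; simp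
  have hacoe : ∀ k : ℕ, (((k : ℝ≥0) * t / N : ℝ≥0) : ℝ) = a k := fun k => by simp [ha]
  have hterm : ∀ k < N,
      IntervalIntegrable (fun s => h (t - s) * Y (gridCeil t N s.toNNReal)) volume
        (a k) (a (k + 1)) ∧
      ∫ s in a k..a (k + 1), h (t - s) * Y (gridCeil t N s.toNNReal) =
        -((f (((k + 1 : ℕ) : ℝ≥0) * t / N) - f ((k : ℝ≥0) * t / N)) *
          Y (((k + 1 : ℕ) : ℝ≥0) * t / N)) := by
    intro k hk
    have heq : Set.EqOn (fun s => h (t - s) * Y (((k + 1 : ℕ) : ℝ≥0) * t / N))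
        (fun s => h (t - s) * Y (gridCeil t N s.toNNReal)) (Set.uIoc (a k) (a (k + 1))) := by
      intro s hs
      rw [Set.uIoc_of_le (hmono k)] at hs
      have hak : 0 ≤ a k := by simp only [ha]; positivity
      have hs0 : 0 ≤ s := hak.trans hs.1.le
      have htR : (0 : ℝ) < t := ht
      have : ⌈s.toNNReal * N / t⌉₊ = k + 1 := by
        rw [Nat.ceil_eq_iff (Nat.succ_ne_zero k), Nat.succ_sub_one]
        constructor
        · rw [lt_div_iff₀ ht, ← NNReal.coe_lt_coe]
          push_cast
          rw [Real.coe_toNNReal _ hs0]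
          exact (div_lt_iff₀ hNR).1 hs.1
        · rw [div_le_iff₀ ht, ← NNReal.coe_le_coe]
          push_cast
          rw [Real.coe_toNNReal _ hs0]
          have := (le_div_iff₀ hNR).1 hs.2
          push_cast at this
          exact this
      simp only [gridCeil, this]
    have hhc : Continuous fun s : ℝ => h (t - s) * Y (((k + 1 : ℕ) : ℝ≥0) * t / N) :=
      (hh.comp (continuous_const.sub continuous_id)).mul continuous_const
    refine ⟨(hhc.intervalIntegrable _ _).congr heq, ?_⟩
    rw [← intervalIntegral.integral_congr_ae (Eventually.of_forall fun s hs => heq hs),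
      intervalIntegral.integral_mul_const, intervalIntegral.integral_comp_sub_left, hf _ (hle _ hk), hf _ (hle _ hk.le), hacoe, hacoe,
      ← intervalIntegral.integral_interval_sub_left (hh.intervalIntegrable 0 _)
        (hh.intervalIntegrable 0 _)]
    ring
  have hsum := intervalIntegral.sum_integral_adjacent_intervals fun k hk => (hterm k hk).1
  have ha0 : a 0 = 0 := by simp [ha]
  have haN : a N = t := by rw [← hacoe, hNt]
  rw [ha0, haN] at hsum
  rw [← hsum, Finset.sum_congr rfl fun k hk => (hterm k (Finset.mem_range.1 hk)).2,
    Finset.sum_neg_distrib]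
  ring

end IsCadlagPath

/-! ### The modulus at small scales -/

/-- On the rational points of `[a, b]`, the oscillation of `w` at small scales is at most `δ`. -/
def HasSmallModulus (w : ℚ≥0 → ℝ) (a b : ℚ≥0) (δ : ℝ) : Prop :=
  ∃ N : ℕ, ∀ r s : ℚ≥0, r ∈ Set.Icc a b → s ∈ Set.Icc a b → |(r : ℝ) - s| < 1 / ((N : ℝ) + 1) →
    |w r - w s| ≤ δ

namespace HasSmallModulus

variable {w w' : ℚ≥0 → ℝ} {a b : ℚ≥0} {δ δ' : ℝ}

theorem add (h : HasSmallModulus w a b δ) (h' : HasSmallModulus w' a b δ') :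
    HasSmallModulus (fun r => w r + w' r) a b (δ + δ') := by
  obtain ⟨N, hN⟩ := h
  obtain ⟨N', hN'⟩ := h'
  refine ⟨max N N', fun r s hr hs hrs => ?_⟩
  have e : w r + w' r - (w s + w' s) = (w r - w s) + (w' r - w' s) := by ring
  rw [e]
  refine (abs_add_le _ _).trans (add_le_add (hN r s hr hs (hrs.trans_le ?_))
    (hN' r s hr hs (hrs.trans_le ?_)))
  · exact one_div_le_one_div_of_le (by positivity) (by gcongr; exact le_max_left _ _)
  · exact one_div_le_one_div_of_le (by positivity) (by gcongr; exact le_max_right _ _)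

theorem const_mul (h : HasSmallModulus w a b δ) (c : ℝ) :
    HasSmallModulus (fun r => c * w r) a b (|c| * δ) := by
  obtain ⟨N, hN⟩ := h
  refine ⟨N, fun r s hr hs hrs => ?_⟩
  rw [← mul_sub, abs_mul]
  exact mul_le_mul_of_nonneg_left (hN r s hr hs hrs) (abs_nonneg c)

theorem sub (h : HasSmallModulus w a b δ) (h' : HasSmallModulus w' a b δ') :
    HasSmallModulus (fun r => w r - w' r) a b (δ + δ') := by
  simpa [sub_eq_add_neg] using h.add (h'.const_mul (-1))

theorem mono_right (h : HasSmallModulus w a b δ) (hδ : δ ≤ δ') : HasSmallModulus w a b δ' := by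
  obtain ⟨N, hN⟩ := h
  exact ⟨N, fun r s hr hs hrs => (hN r s hr hs hrs).trans hδ⟩

theorem mono_interval (h : HasSmallModulus w a b δ) {a' b' : ℚ≥0} (ha : a ≤ a') (hb : b' ≤ b) :
    HasSmallModulus w a' b' δ := by
  obtain ⟨N, hN⟩ := h
  exact ⟨N, fun r s hr hs hrs => hN r s (Set.Icc_subset_Icc ha hb hr)
    (Set.Icc_subset_Icc ha hb hs) hrs⟩

theorem of_forall (h : ∀ r ∈ Set.Icc a b, ∀ s ∈ Set.Icc a b, |w r - w s| ≤ δ) :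
    HasSmallModulus w a b δ :=
  ⟨0, fun r s hr hs _ => h r hr s hs⟩

theorem of_continuous {g : ℝ≥0 → ℝ} (hg : Continuous g) (a b : ℚ≥0) (hδ : 0 < δ) :
    HasSmallModulus (fun r => g r) a b δ := by
  have hu := (isCompact_Icc (a := (a : ℝ≥0)) (b := (b : ℝ≥0))).uniformContinuousOn_of_continuous
    hg.continuousOn
  obtain ⟨ε, hε, h⟩ := Metric.uniformContinuousOn_iff.1 hu δ hδ
  obtain ⟨N, hN⟩ := exists_nat_one_div_lt hε
  refine ⟨N, fun r s hr hs hrs => ?_⟩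
  have hcast : ∀ q ∈ Set.Icc a b, (q : ℝ≥0) ∈ Set.Icc (a : ℝ≥0) (b : ℝ≥0) := fun q hq =>
    ⟨NNRat.cast_le.2 hq.1, NNRat.cast_le.2 hq.2⟩
  have := h r (hcast r hr) s (hcast s hs) (by
    rw [NNReal.dist_eq]
    exact_mod_cast hrs.trans hN)
  exact this.le

theorem measurableSet_setOf (a b : ℚ≥0) (δ : ℝ) :
    MeasurableSet {w : ℚ≥0 → ℝ | HasSmallModulus w a b δ} := by
  simp only [HasSmallModulus, Set.ofPred_exists, Set.ofPred_forall]
  refine MeasurableSet.iUnion fun N => MeasurableSet.iInter fun r => MeasurableSet.iInter fun s =>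
    MeasurableSet.iInter fun _ => MeasurableSet.iInter fun _ => MeasurableSet.iInter fun _ => ?_
  exact measurableSet_le (((measurable_pi_apply r).sub (measurable_pi_apply s)).abs)
    measurable_const

end HasSmallModulus

/-! ### Jumps of a Lévy process detected by grid increments -/

/-- The cell around `τ` has its right end tending to `τ` from the right, possibly equal to it, and
its left end tending to `τ` strictly from the left, so the increment over it tends to the jump. -/
theorem IsCadlagPath.tendsto_grid_increment {Y : ℝ≥0 → ℝ} (hY : IsCadlagPath Y) {c h τ : ℝ≥0}
    (h1 : c < τ) (h2 : τ ≤ c + h) {δ : ℝ} (hδ : δ < |pathJump Y τ|) :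
    ∀ᶠ N : ℕ in atTop, ∃ k < N, δ < |Y (c + ((k + 1 : ℕ) : ℝ≥0) * (h / N)) -
      Y (c + (k : ℝ≥0) * (h / N))| := by
  have hτ : 0 < τ := (zero_le).trans_lt h1
  have hh : 0 < h := by
    by_contra hh
    have : h = 0 := le_antisymm (not_lt.1 hh) zero_le
    rw [this, add_zero] at h2
    exact absurd h1 (not_lt.2 h2)
  obtain ⟨l, hl⟩ := hY.2 τ hτ
  have hne : (𝓝[<] τ).NeBot := nhdsLT_neBot_of_exists_lt ⟨c, h1⟩
  have hjump : pathJump Y τ = Y τ - l := by rw [pathJump, leftLim_eq_of_tendsto hl]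
  -- Ceiling minus one, rather than floor, keeps the left end strictly before `τ` even when `τ` is a
  -- grid point.
  set k : ℕ → ℕ := fun N => ⌈(τ - c) * N / h⌉₊ - 1 with hk
  have hpos : ∀ N : ℕ, 0 < N → 0 < (τ - c) * N / h := fun N hN => by
    have : (0 : ℝ≥0) < N := by exact_mod_cast hN
    have := tsub_pos_of_lt h1
    positivity
  have hk1 : ∀ N : ℕ, 0 < N → k N + 1 = ⌈(τ - c) * N / h⌉₊ := fun N hN => by
    have := Nat.ceil_pos.2 (hpos N hN)
    simp only [hk]; omega
  have hR : ∀ N : ℕ, 0 < N →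
      c + ((k N + 1 : ℕ) : ℝ≥0) * (h / N) = c + gridCeil h N (τ - c) := fun N hN => by
    rw [hk1 N hN, gridCeil, ← mul_div_assoc]
  have hcτ : c + (τ - c) = τ := add_tsub_cancel_of_le h1.le
  have tR : Tendsto (fun N => c + gridCeil h N (τ - c)) atTop (𝓝[≥] τ) := by
    have t1 := tendsto_gridCeil hh (τ - c)
    refine tendsto_nhdsWithin_of_tendsto_nhds_of_eventually_within _ ?_ ?_
    · have := (t1.mono_right nhdsWithin_le_nhds).const_add c
      rwa [hcτ] at this
    · filter_upwards [eventually_gt_atTop 0] with N hN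
      calc τ = c + (τ - c) := hcτ.symm
        _ ≤ _ := by gcongr; exact le_gridCeil hh hN _
  have hL : ∀ N : ℕ, 0 < N → c + ((k N + 1 : ℕ) : ℝ≥0) * (h / N) =
      (c + (k N : ℝ≥0) * (h / N)) + h / N := fun N _ => by
    push_cast; ring
  have hLlt : ∀ N : ℕ, 0 < N → c + (k N : ℝ≥0) * (h / N) < τ := fun N hN => by
    have hN' : (0 : ℝ≥0) < N := by exact_mod_cast hN
    have : (k N : ℝ≥0) < (τ - c) * N / h := by
      refine Nat.lt_ceil.1 ?_
      rw [← hk1 N hN]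
      exact Nat.lt_succ_self _
    rw [lt_div_iff₀ hh] at this
    have h3 : (k N : ℝ≥0) * (h / N) < τ - c := by
      rw [← mul_div_assoc, div_lt_iff₀ hN']
      exact this
    calc c + (k N : ℝ≥0) * (h / N) < c + (τ - c) := by gcongr
      _ = τ := hcτ
  have tL : Tendsto (fun N : ℕ => c + (k N : ℝ≥0) * (h / N)) atTop (𝓝[<] τ) := by
    refine tendsto_nhdsWithin_of_tendsto_nhds_of_eventually_within _ ?_ ?_
    · have t1 := tR.mono_right nhdsWithin_le_nhds
      rw [← NNReal.tendsto_coe] at t1 ⊢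
      have t2 := t1.sub (tendsto_const_div_atTop_nhds_zero_nat (h : ℝ))
      rw [sub_zero] at t2
      refine t2.congr' ?_
      filter_upwards [eventually_gt_atTop 0] with N hN
      rw [← hR N hN, hL N hN]
      push_cast
      ring
    · filter_upwards [eventually_gt_atTop 0] with N hN using hLlt N hN
  have tY := ((hY.tendsto_nhdsGE τ).comp tR).sub (hl.comp tL)
  rw [← hjump] at tY
  filter_upwards [tY.abs.eventually (lt_mem_nhds hδ), eventually_gt_atTop 0] with N hN hN0
  refine ⟨k N, ?_, ?_⟩
  · have hN' : (0 : ℝ≥0) < N := by exact_mod_cast hN0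
    rw [← Nat.succ_le_iff, Nat.succ_eq_add_one, hk1 N hN0, Nat.ceil_le, div_le_iff₀ hh, mul_comm]
    gcongr
    exact tsub_le_iff_left.2 h2
  · rw [hR N hN0]
    exact hN

namespace IsLevyProcess

variable {Ω : Type*} [MeasurableSpace Ω] {P : Measure Ω} {Y : ℝ≥0 → Ω → ℝ}

theorem measure_grid_increments_le (hY : IsLevyProcess P Y) (c d : ℝ≥0) (N : ℕ) (δ : ℝ) :
    P {ω | ∀ k < N, |Y (c + ((k + 1 : ℕ) : ℝ≥0) * d) ω - Y (c + (k : ℝ≥0) * d) ω| ≤ δ} =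
      P {ω | |Y d ω| ≤ δ} ^ N := by
  have hB : MeasurableSet {x : ℝ | |x| ≤ δ} := measurableSet_le measurable_id.abs measurable_const
  have hind := hY.indep N (fun i => c + (i : ℕ) * d) (fun i j hij => by
    have : (i : ℕ) ≤ j := hij
    dsimp only
    gcongr)
  have h := hind.meas_iInter (s := fun i : Fin N => {ω | |Y (c + ((i : ℕ) + 1 : ℕ) * d) ω -
    Y (c + (i : ℕ) * d) ω| ≤ δ}) fun i => ⟨_, hB, by ext ω; simp⟩
  have hset : {ω | ∀ k < N, |Y (c + ((k + 1 : ℕ) : ℝ≥0) * d) ω - Y (c + (k : ℝ≥0) * d) ω| ≤ δ} =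
      ⋂ i : Fin N, {ω | |Y (c + ((i : ℕ) + 1 : ℕ) * d) ω - Y (c + (i : ℕ) * d) ω| ≤ δ} := by
    ext ω
    simp only [Set.mem_ofPred_eq, Set.mem_iInter]
    exact ⟨fun h i => h i i.2, fun h k hk => h ⟨k, hk⟩⟩
  rw [hset, h]
  have hterm : ∀ i : Fin N, P {ω | |Y (c + ((i : ℕ) + 1 : ℕ) * d) ω - Y (c + (i : ℕ) * d) ω| ≤ δ}
      = P {ω | |Y d ω| ≤ δ} := fun i => by
    have h1 := (hY.stationary (c + (i : ℕ) * d) d).measure_mem_eq hB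
    have e : c + (i : ℕ) * d + d = c + ((i : ℕ) + 1 : ℕ) * d := by push_cast; ring
    rw [e] at h1
    exact h1
  rw [Finset.prod_congr rfl fun i _ => hterm i, Finset.prod_const, Finset.card_univ,
    Fintype.card_fin]

theorem measurableSet_grid_increments (hY : IsLevyProcess P Y) (c d : ℝ≥0) (N : ℕ) (δ : ℝ) :
    MeasurableSet
      {ω | ∀ k < N, |Y (c + ((k + 1 : ℕ) : ℝ≥0) * d) ω - Y (c + (k : ℝ≥0) * d) ω| ≤ δ} := by
  simp only [Set.ofPred_forall]
  exact MeasurableSet.iInter fun k => MeasurableSet.iInter fun _ =>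
    measurableSet_le ((hY.measurable _).sub (hY.measurable _)).abs measurable_const

/-- If a Lévy process has no large jumps on one interval, it has none on any later interval of the
same length. -/
theorem ae_jump_le_of_ae_hasSmallModulus [IsProbabilityMeasure P]
    (hY : IsLevyProcess P Y) {a b : ℚ≥0} (hab : a < b) {δ : ℝ}
    (h : ∀ᵐ ω ∂P, HasSmallModulus (fun r => Y r ω) a b δ) :
    ∀ᵐ ω ∂P, ∀ τ : ℝ≥0, 0 < τ → |pathJump (fun t => Y t ω) τ| ≤ δ := by
  set d : ℝ≥0 := ((b - a : ℚ≥0) : ℝ≥0) with hd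
  have hd0 : 0 < d := NNRat.cast_pos.2 (tsub_pos_of_lt hab)
  set G : ℝ≥0 → ℕ → Set Ω := fun c N => {ω | ∀ k < N,
    |Y (c + ((k + 1 : ℕ) : ℝ≥0) * (d / N)) ω - Y (c + (k : ℝ≥0) * (d / N)) ω| ≤ δ} with hG
  have hGm : ∀ c N, MeasurableSet (G c N) := fun c N => hY.measurableSet_grid_increments c _ N δ
  -- Both sides equal `P {|Y (d / N)| ≤ δ} ^ N`, whatever the starting point.
  have hmeas : ∀ c N, P (G c N) = P (G a N) := fun c N => by
    rw [hG]
    simp only [hY.measure_grid_increments_le]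
  have hev : ∀ᵐ ω ∂P, ∀ᶠ N in atTop, ω ∈ G a N := by
    filter_upwards [h] with ω ⟨M, hM⟩
    have t1 : Tendsto (fun N : ℕ => (d : ℝ) / N) atTop (𝓝 0) :=
      tendsto_const_div_atTop_nhds_zero_nat (d : ℝ)
    filter_upwards [t1.eventually (gt_mem_nhds (show (0 : ℝ) < 1 / ((M : ℝ) + 1) by positivity)),
      eventually_gt_atTop 0] with N hN hN0 k hk
    have hNq : (0 : ℚ≥0) < N := by exact_mod_cast hN0
    have hle : ∀ j : ℕ, j ≤ N → a + j * ((b - a) / N) ∈ Set.Icc a b := fun j hj => by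
      refine ⟨le_self_add, ?_⟩
      calc a + j * ((b - a) / N) ≤ a + N * ((b - a) / N) := by gcongr
        _ = b := by
          rw [mul_div_cancel₀ _ hNq.ne', add_tsub_cancel_of_le hab.le]
    have hcast : ∀ j : ℕ, ((a + j * ((b - a) / N) : ℚ≥0) : ℝ≥0) = a + j * (d / N) := fun j => by
      rw [hd]; push_cast; rfl
    have := hM _ _ (hle (k + 1) hk) (hle k hk.le) (by
      have e1 : (((a + (k + 1 : ℕ) * ((b - a) / N) : ℚ≥0) : ℝ)) -
          ((a + k * ((b - a) / N) : ℚ≥0) : ℝ) = d / N := by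
        have e2 : (a + (k + 1 : ℕ) * ((b - a) / N) : ℚ≥0) =
            (a + k * ((b - a) / N)) + (b - a) / N := by push_cast; ring
        rw [e2, NNRat.cast_add, add_sub_cancel_left, hd]
        push_cast
        rfl
      rw [e1, abs_of_nonneg (by positivity)]
      exact hN)
    simpa only [hcast] using this
  have hlim : Tendsto (fun N => P (G a N)) atTop (𝓝 1) := by
    have := tendsto_measure_of_ae_tendsto_indicator_of_isFiniteMeasure (μ := P) atTop
      (A := Set.univ) MeasurableSet.univ (As := fun N => G a N) (hGm a)
      (by filter_upwards [hev] with ω hω; filter_upwards [hω] with N hN; simp [hN])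
    simpa using this
  have hcompl : ∀ c, Tendsto (fun N => P (G c N)ᶜ) atTop (𝓝 0) := fun c => by
    have : (fun N => P (G c N)ᶜ) = fun N => 1 - P (G a N) := by
      funext N
      rw [prob_compl_eq_one_sub (hGm c N), hmeas]
    rw [this]
    simpa using ENNReal.Tendsto.sub tendsto_const_nhds hlim (Or.inl ENNReal.one_ne_top)
  -- A jump larger than `δ` in `(c, c + d]` would put `ω` in all late complements, whose measures
  -- tend to `0`.
  have hnull : ∀ c, ∀ᵐ ω ∂P, ¬ ∀ᶠ N in atTop, ω ∈ (G c N)ᶜ := fun c => by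
    simp only [eventually_atTop, not_exists, ae_all_iff]
    intro M
    have hz : P (⋂ N ≥ M, (G c N)ᶜ) = 0 := by
      refine le_antisymm (ge_of_tendsto (hcompl c) ?_) zero_le
      filter_upwards [eventually_ge_atTop M] with N hN
      exact measure_mono (Set.biInter_subset_of_mem hN)
    filter_upwards [measure_eq_zero_iff_ae_notMem.1 hz] with ω hω hall
    exact hω (Set.mem_iInter₂.2 hall)
  have hall : ∀ᵐ ω ∂P, ∀ j : ℕ, ¬ ∀ᶠ N in atTop, ω ∈ (G (j * d) N)ᶜ :=
    ae_all_iff.2 fun j => hnull _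
  filter_upwards [hall, hY.cadlag] with ω hω hc τ hτ
  by_contra hcon
  rw [not_le] at hcon
  set j := ⌈τ / d⌉₊ - 1 with hj
  have hj1 : j + 1 = ⌈τ / d⌉₊ := by
    have := Nat.ceil_pos.2 (show 0 < τ / d by positivity)
    omega
  have h1 : (j : ℝ≥0) * d < τ := by
    rw [← lt_div_iff₀ hd0]
    exact Nat.lt_ceil.1 (by omega)
  have h2 : τ ≤ (j : ℝ≥0) * d + d := by
    have := Nat.le_ceil (τ / d)
    rw [← hj1, div_le_iff₀ hd0] at this
    push_cast at this
    rwa [add_mul, one_mul] at this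
  refine hω j ((hc.tendsto_grid_increment h1 h2 hcon).mono fun N hN => ?_)
  obtain ⟨k, hk, hk'⟩ := hN
  exact fun hG' => absurd (hG' k hk) (not_le.2 hk')

/-- Otherwise every `δ = 1 / (m + 1)` would have an interval of almost surely small modulus; by
stationarity all jumps would be at most every such `δ`, so there would be none. -/
theorem exists_not_ae_hasSmallModulus [IsProbabilityMeasure P]
    (hY : IsLevyProcess P Y) {B : Set ℝ}
    (hB : jumpIntensity P Y B ≠ 0) :
    ∃ δ : ℝ, 0 < δ ∧ ∀ a b : ℚ≥0, a < b →
      ¬ ∀ᵐ ω ∂P, HasSmallModulus (fun r => Y r ω) a b δ := by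
  by_contra! hcon
  refine hB ?_
  have h : ∀ᵐ ω ∂P, ∀ m : ℕ, ∀ τ : ℝ≥0, 0 < τ →
      |pathJump (fun t => Y t ω) τ| ≤ 1 / ((m : ℝ) + 1) := by
    refine ae_all_iff.2 fun m => ?_
    obtain ⟨a, b, hab, h⟩ := hcon (1 / ((m : ℝ) + 1)) (by positivity)
    exact hY.ae_jump_le_of_ae_hasSmallModulus hab h
  rw [jumpIntensity, lintegral_congr_ae (g := fun _ => 0), lintegral_zero]
  filter_upwards [h] with ω hω
  have hempty : {s : ℝ≥0 | 0 < s ∧ s ≤ 1 ∧ pathJump (fun t => Y t ω) s ≠ 0 ∧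
      pathJump (fun t => Y t ω) s ∈ B} = ∅ := by
    ext s
    simp only [Set.mem_ofPred_eq, Set.mem_empty_iff_false, iff_false]
    rintro ⟨hs, -, hne, -⟩
    obtain ⟨m, hm⟩ := exists_nat_one_div_lt (abs_pos.2 hne)
    exact absurd (hω m s hs) (not_le.2 hm)
  rw [hempty]
  simp

end IsLevyProcess

/-! ### Symmetrization -/

namespace IsLevyProcess

variable {Ω : Type*} [MeasurableSpace Ω] {P : Measure Ω} {Y : ℝ≥0 → Ω → ℝ}

/-- Right continuity at `a` makes almost every path nearly constant on some `[a, b' n]` with `b' n`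
decreasing to `a`; countably many null events cannot cover this. -/
theorem exists_measure_oscillation_ne_zero [IsProbabilityMeasure P] (hY : IsLevyProcess P Y)
    {a b : ℚ≥0} (hab : a < b) {δ : ℝ} (hδ : 0 < δ) :
    ∃ b', a < b' ∧ b' ≤ b ∧ P {ω | HasSmallModulus (fun r => Y r ω) a b' δ} ≠ 0 := by
  by_contra! hcon
  have hba : 0 < b - a := tsub_pos_of_lt hab
  set b' : ℕ → ℚ≥0 := fun n => a + (b - a) / (n + 1) with hb'
  have h1 : ∀ n, a < b' n := fun n => lt_add_of_pos_right _ (by positivity)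
  have h2 : ∀ n, b' n ≤ b := fun n => by
    calc a + (b - a) / (n + 1) ≤ a + (b - a) := by
          gcongr
          exact div_le_self zero_le (by simp)
      _ = b := add_tsub_cancel_of_le hab.le
  have h0 := measure_iUnion_null fun n => hcon (b' n) (h1 n) (h2 n)
  have h3 : ∀ᵐ ω ∂P, ω ∈ ⋃ n, {ω | HasSmallModulus (fun r => Y r ω) a (b' n) δ} := by
    filter_upwards [hY.cadlag] with ω hω
    have ht := hω.tendsto_nhdsGE (a : ℝ≥0)
    have hev : ∀ᶠ s in 𝓝[≥] (a : ℝ≥0), dist (Y s ω) (Y a ω) < δ / 2 :=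
      ht.eventually (Metric.ball_mem_nhds _ (half_pos hδ))
    rw [eventually_nhdsWithin_iff, Metric.eventually_nhds_iff] at hev
    obtain ⟨ε, hε, hev⟩ := hev
    have tn : Tendsto (fun n : ℕ => ((b - a : ℚ≥0) : ℝ) * (1 / ((n : ℝ) + 1))) atTop (𝓝 0) := by
      simpa using tendsto_one_div_add_atTop_nhds_zero_nat.const_mul ((b - a : ℚ≥0) : ℝ)
    obtain ⟨n, hn⟩ := (tn.eventually (gt_mem_nhds hε)).exists
    have hclose : ∀ r ∈ Set.Icc a (b' n), dist (Y r ω) (Y a ω) < δ / 2 := fun r hr => by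
      refine hev ?_ (Set.mem_Ici.2 (NNRat.cast_le.2 hr.1))
      have e1 : (a : ℝ) ≤ r := NNRat.cast_le.2 hr.1
      have e2 : (r : ℝ) ≤ (b' n : ℚ≥0) := NNRat.cast_le.2 hr.2
      simp only [hb'] at e2
      push_cast at e2
      rw [NNReal.dist_eq]
      have e3 : (((r : ℝ≥0) : ℝ)) - ((a : ℝ≥0) : ℝ) = (r : ℝ) - a := rfl
      rw [e3, abs_of_nonneg (by linarith)]
      have e4 : ((b - a : ℚ≥0) : ℝ) * (1 / ((n : ℝ) + 1)) = ((b - a : ℚ≥0) : ℝ) / (n + 1) := by ring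
      rw [e4] at hn
      linarith
    refine Set.mem_iUnion.2 ⟨n, HasSmallModulus.of_forall fun r hr s hs => ?_⟩
    have := dist_triangle_right (Y r ω) (Y s ω) (Y a ω)
    rw [Real.dist_eq] at this
    linarith [hclose r hr, hclose s hs]
  have h4 := prob_compl_eq_zero_iff₀ (μ := P) (NullMeasurableSet.of_null h0) |>.1 h3
  rw [h0] at h4
  exact zero_ne_one h4

theorem measurable_rat (hY : IsLevyProcess P Y) : Measurable fun ω (r : ℚ≥0) => Y r ω :=
  measurable_pi_lambda _ fun r => hY.measurable r

/-- Symmetrization: no deterministic shift can make the modulus of a Lévy process small with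
probability close to one. -/
theorem exists_bound_shift_hasSmallModulus [IsProbabilityMeasure P] (hY : IsLevyProcess P Y)
    {δ : ℝ} (hδ : 0 < δ)
    (h : ∀ a b : ℚ≥0, a < b → ¬ ∀ᵐ ω ∂P, HasSmallModulus (fun r => Y r ω) a b δ)
    {a b : ℚ≥0} (hab : a < b) :
    ∃ q : ℝ≥0∞, q < 1 ∧ ∀ y : ℚ≥0 → ℝ,
      P {ω | HasSmallModulus (fun r => Y r ω + y r) a b (δ / 4)} ≤ q := by
  set D : Set (Ω × Ω) := {p | HasSmallModulus (fun r => Y r p.1 - Y r p.2) a b (δ / 2)} with hD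
  have hDm : MeasurableSet D :=
    ((hY.measurable_rat.comp measurable_fst).sub (hY.measurable_rat.comp measurable_snd))
      (HasSmallModulus.measurableSet_setOf a b (δ / 2))
  have hQ : (P.prod P) D < 1 := by
    refine lt_of_le_of_ne prob_le_one fun hone => ?_
    have hcompl : (P.prod P) Dᶜ = 0 := by
      rw [prob_compl_eq_one_sub hDm, hone, tsub_self]
    obtain ⟨b', hab', hb', hA⟩ := hY.exists_measure_oscillation_ne_zero hab (half_pos hδ)
    -- If the difference of two copies were almost surely `δ / 2`-small, adding back a copy that is
    -- `δ / 2`-small with positive probability would make `Y` almost surely `δ`-small on `[a, b']`.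
    have hsub : {ω | ¬ HasSmallModulus (fun r => Y r ω) a b' δ} ×ˢ
        {ω | HasSmallModulus (fun r => Y r ω) a b' (δ / 2)} ⊆ Dᶜ := by
      rintro ⟨ω, ω'⟩ ⟨h1, h2⟩ h3
      refine h1 ?_
      have := (HasSmallModulus.mono_interval h3 le_rfl hb').add h2
      simpa using this
    have hz := measure_mono_null hsub hcompl
    rw [Measure.prod_prod, mul_eq_zero] at hz
    exact hz.elim (h a b' hab') hA
  -- The shift `y` cancels in the difference of two independent copies, so the squared probability
  -- is at most that of `D`; hence the square root.
  refine ⟨(P.prod P) D ^ (2 : ℝ)⁻¹, ENNReal.rpow_lt_one hQ (by norm_num), fun y => ?_⟩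
  rw [ENNReal.le_rpow_inv_iff (by norm_num), ENNReal.rpow_ofNat, sq, ← Measure.prod_prod]
  refine measure_mono ?_
  rintro ⟨ω, ω'⟩ ⟨h1, h2⟩
  have := HasSmallModulus.sub h1 h2
  have e : δ / 4 + δ / 4 = δ / 2 := by ring
  rw [e] at this
  show HasSmallModulus (fun r => Y r ω - Y r ω') a b (δ / 2)
  simpa using this

end IsLevyProcess

/-! ### Measurability with respect to a subfamily of the processes -/

/-- The σ-algebra `m` need not contain the null sets, so the limit itself may fail to be
`m`-measurable; the `limsup` of `m`-measurable versions is. -/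
theorem exists_measurable_ae_eq_of_tendsto_ae {Ω : Type*} {m : MeasurableSpace Ω}
    {m₀ : MeasurableSpace Ω} {P : Measure[m₀] Ω} {f : ℕ → Ω → ℝ} {g : Ω → ℝ}
    (hf : ∀ n, ∃ f', Measurable[m] f' ∧ f n =ᵐ[P] f')
    (h : ∀ᵐ ω ∂P, Tendsto (fun n => f n ω) atTop (𝓝 (g ω))) :
    ∃ g', Measurable[m] g' ∧ g =ᵐ[P] g' := by
  choose f' hf' hff' using hf
  refine ⟨fun ω => limsup (fun n => f' n ω) atTop, Measurable.limsup hf', ?_⟩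
  filter_upwards [h, ae_all_iff.2 hff'] with ω hω hω'
  simp only [hω'] at hω
  exact hω.limsup_eq.symm

theorem exists_measurable_ae_eq_sum_mul {Ω : Type*} {m₀ : MeasurableSpace Ω} {P : Measure[m₀] Ω}
    {m : MeasurableSpace Ω} (s : Finset ℕ) (c : ℕ → ℝ) {f : ℕ → Ω → ℝ}
    (hf : ∀ n ∈ s, ∃ f', Measurable[m] f' ∧ f n =ᵐ[P] f') :
    ∃ f', Measurable[m] f' ∧ (fun ω => ∑ n ∈ s, c n * f n ω) =ᵐ[P] f' := by
  choose! f' h1 h2 using hf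
  refine ⟨fun ω => ∑ n ∈ s, c n * f' n ω,
    Finset.measurable_fun_sum _ fun n hn => (h1 n hn).const_mul _, ?_⟩
  filter_upwards [(ae_ball_iff s.countable_toSet).2 h2] with ω hω
  exact Finset.sum_congr rfl fun n hn => by rw [hω n hn]

/-- The σ-algebra generated by the processes `L n`, `n ∈ s`. -/
abbrev pathSigma {Ω : Type*} (L : ℕ → ℝ≥0 → Ω → ℝ) (s : Set ℕ) : MeasurableSpace Ω :=
  ⨆ n ∈ s, MeasurableSpace.comap (fun ω (t : ℝ≥0) => L n t ω) inferInstance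

theorem measurable_pathSigma {Ω : Type*} (L : ℕ → ℝ≥0 → Ω → ℝ) {s : Set ℕ} {n : ℕ} (hn : n ∈ s)
    (t : ℝ≥0) : Measurable[pathSigma L s] (L n t) := by
  have h1 : Measurable[MeasurableSpace.comap (fun ω (t : ℝ≥0) => L n t ω) inferInstance] (L n t) :=
    (measurable_pi_apply t).comp (comap_measurable fun ω (t : ℝ≥0) => L n t ω)
  exact h1.mono (le_iSup₂_of_le n hn le_rfl) le_rfl

theorem measurable_of_forall_apply {Ω F T : Type*} {m : MeasurableSpace Ω} {U : Ω → F → T → ℝ}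
    (h : ∀ k r, Measurable fun ω => U ω k r) : Measurable U :=
  measurable_pi_lambda _ fun k => measurable_pi_lambda _ fun r => h k r

namespace IsStochIntegral

variable {Ω : Type*} [m₀ : MeasurableSpace Ω] {P : Measure Ω} {Y : ℝ≥0 → Ω → ℝ}
  {f : ℝ≥0 → ℝ} {t : ℝ≥0} {I : Ω → ℝ}

theorem exists_measurable_ae_eq (hI : IsStochIntegral P f Y t I) {m : MeasurableSpace Ω}
    (hY : ∀ t, Measurable[m] (Y t)) : ∃ I', Measurable[m] I' ∧ I =ᵐ[P] I' := by
  obtain ⟨ns, -, hns⟩ := TendstoInMeasure.exists_seq_tendsto_ae hI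
  refine exists_measurable_ae_eq_of_tendsto_ae (fun n => ⟨_, ?_, ae_eq_rfl⟩) hns
  exact Finset.measurable_fun_sum _ fun k _ => ((hY _).sub (hY _)).const_mul _

theorem ae_eq_add_convolution (hI : IsStochIntegral P f Y t I)
    (hcad : ∀ᵐ ω ∂P, IsCadlagPath fun s => Y s ω) (hzero : ∀ᵐ ω ∂P, Y 0 ω = 0)
    {h : ℝ → ℝ} (hh : Continuous h) (c : ℝ)
    (hf : ∀ s ≤ t, f s = c + ∫ u in (0 : ℝ)..((t : ℝ) - s), h u) :
    ∀ᵐ ω ∂P, I ω = c * Y t ω + ∫ s in (0 : ℝ)..t, h (t - s) * Y s.toNNReal ω := by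
  obtain ⟨ns, hmono, hns⟩ := TendstoInMeasure.exists_seq_tendsto_ae hI
  filter_upwards [hns, hcad, hzero] with ω h1 h2 h3
  exact tendsto_nhds_unique h1 ((h2.tendsto_riemannSum h3 hh c t hf).comp hmono.tendsto_atTop)

end IsStochIntegral

/-! ### Coordinates of the stochastic convolution -/

section

variable {Ω : Type*} [m₀ : MeasurableSpace Ω] {P : Measure Ω}
  {H : Type*} [NormedAddCommGroup H] [InnerProductSpace ℝ H]
  {S : C0Semigroup H} {e : HilbertBasis ℕ ℝ H} {β : ℕ → ℝ} {L : ℕ → ℝ≥0 → Ω → ℝ} {X : ℝ≥0 → Ω → H}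

/-- The `k`-th coordinate of the convolution is `β k * L k`, plus a continuous process, plus a
process which depends only on the `L n` with `n ∉ F`. -/
theorem IsStochConvolution.exists_coord_decomposition [CompleteSpace H]
    (hX : IsStochConvolution P S e β L X) (hL : ∀ n, IsLevyProcess P (L n))
    {F : Finset ℕ} {k : ℕ} (hk : k ∈ F) (he : e k ∈ (S.generator†).domain) :
    ∃ R : ℚ≥0 → Ω → ℝ,
      (∀ r, Measurable[pathSigma L (F : Set ℕ)ᶜ] (R r)) ∧
      ∀ᵐ ω ∂P, ∃ g : ℝ≥0 → ℝ, Continuous g ∧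
        ∀ r : ℚ≥0, ⟪X r ω, e k⟫_ℝ = β k * L k r ω + R r ω + g r := by
  obtain ⟨z, hz⟩ := S.exists_inner_eq_add_integral he
  set h : ℕ → ℝ → ℝ := fun n u => ⟪S.op u.toNNReal (e n), z⟫_ℝ with hh
  have hhc : ∀ n, Continuous (h n) := fun n =>
    (S.continuous_orbit_toNNReal (e n)).inner continuous_const
  set Γ : ℕ → Ω → ℝ≥0 → ℝ := fun n ω t =>
    ∫ s in (0 : ℝ)..t, h n (t - s) * L n s.toNNReal ω with hΓ
  choose I hI hlim using fun r : ℚ≥0 => hX.coord (r : ℝ≥0) k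
  have hform : ∀ (r : ℚ≥0) n, ∀ᵐ ω ∂P, I r n ω = ⟪e n, e k⟫_ℝ * L n r ω + Γ n ω r := fun r n => by
    refine (hI r n).ae_eq_add_convolution (hL n).cadlag (hL n).zero (hhc n) _ fun s hs => ?_
    rw [hz, NNReal.coe_sub hs]
  have hR : ∀ r : ℚ≥0, ∃ R, Measurable[pathSigma L (F : Set ℕ)ᶜ] R ∧
      (fun ω => ⟪X r ω, e k⟫_ℝ - ∑ n ∈ F, β n * I r n ω) =ᵐ[P] R := fun r => by
    obtain ⟨ns, hmono, hns⟩ := TendstoInMeasure.exists_seq_tendsto_ae (hlim r)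
    -- Once the partial sums include `F`, subtracting the terms of `F` leaves sums over indices
    -- outside `F` only.
    refine exists_measurable_ae_eq_of_tendsto_ae (m := pathSigma L (F : Set ℕ)ᶜ)
      (f := fun i ω => ∑ n ∈ Finset.range (ns i) \ F, β n * I r n ω) (fun i => ?_) ?_
    · exact exists_measurable_ae_eq_sum_mul _ β fun n hn => (hI r n).exists_measurable_ae_eq fun t =>
        measurable_pathSigma L (by simpa using (Finset.mem_sdiff.1 hn).2) t
    · obtain ⟨N, hN⟩ := F.exists_nat_subset_range
      filter_upwards [hns] with ω hω
      refine (hω.sub_const _).congr' ?_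
      filter_upwards [eventually_ge_atTop N] with i hi
      rw [sub_eq_iff_eq_add]
      exact (Finset.sum_sdiff (hN.trans
        (Finset.range_subset_range.2 (hi.trans (hmono.id_le i))))).symm
  choose R hRm hRe using hR
  refine ⟨R, hRm, ?_⟩
  have hcad : ∀ᵐ ω ∂P, ∀ n, IsCadlagPath fun t => L n t ω := ae_all_iff.2 fun n => (hL n).cadlag
  filter_upwards [ae_all_iff.2 hRe, ae_all_iff.2 fun r => ae_all_iff.2 (hform r), hcad]
    with ω h1 h2 h3
  refine ⟨fun t => ∑ n ∈ F, β n * Γ n ω t, continuous_finsetSum _ fun n _ =>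
    continuous_const.mul ((h3 n).continuous_convolution (hhc n)), fun r => ?_⟩
  have hsum : ∑ n ∈ F, β n * I r n ω = β k * L k r ω + ∑ n ∈ F, β n * Γ n ω r := by
    simp only [h2, mul_add, Finset.sum_add_distrib]
    congr 1
    -- Orthonormality leaves `L k` as the only process of `F` entering outside a continuous
    -- convolution.
    rw [Finset.sum_eq_single_of_mem k hk]
    · rw [orthonormal_iff_ite.1 e.orthonormal k k]; simp
    · intro n _ hnk
      rw [orthonormal_iff_ite.1 e.orthonormal n k]; simp [hnk]
  have := h1 r
  rw [hsum] at this
  linarith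

/-- The remainders are independent of the `L k` with `k ∈ F`, so Fubini freezes them as shifts; the
frozen events are independent over `k`, and each contributes a factor at most `q`. -/
theorem measure_forall_hasSmallModulus_le [IsProbabilityMeasure P]
    (hL : ∀ n, IsLevyProcess P (L n))
    (hL_indep : iIndepFun (fun n ω (t : ℝ≥0) => L n t ω) P)
    (F : Finset ℕ) {R : F → ℚ≥0 → Ω → ℝ}
    (hR : ∀ k r, Measurable[pathSigma L (F : Set ℕ)ᶜ] (R k r))
    {a b : ℚ≥0} {η : ℝ} {q : ℝ≥0∞}
    (hq : ∀ k ∈ F, ∀ y : ℚ≥0 → ℝ,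
      P {ω | HasSmallModulus (fun r => β k * L k r ω + y r) a b η} ≤ q) :
    P {ω | ∀ k : F, HasSmallModulus (fun r => β k * L k r ω + R k r ω) a b η} ≤ q ^ F.card := by
  set U : Ω → F → ℚ≥0 → ℝ := fun ω k r => L k r ω with hU
  set V : Ω → F → ℚ≥0 → ℝ := fun ω k r => R k r ω with hV
  have hle : ∀ n, MeasurableSpace.comap (fun ω (t : ℝ≥0) => L n t ω) inferInstance ≤ m₀ :=
    fun n => (measurable_pi_lambda _ fun t => (hL n).measurable t).comap_le
  have hUm : Measurable[pathSigma L F] U :=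
    measurable_of_forall_apply fun k r => measurable_pathSigma L k.2 r
  have hVm : Measurable[pathSigma L (F : Set ℕ)ᶜ] V :=
    measurable_of_forall_apply fun k r => hR k r
  have hUm₀ : Measurable U := hUm.mono (iSup₂_le fun n _ => hle n) le_rfl
  have hVm₀ : Measurable V := hVm.mono (iSup₂_le fun n _ => hle n) le_rfl
  have hVU : IndepFun V U P := by
    have h1 := indep_iSup_of_disjoint hle hL_indep.iIndep
      (disjoint_compl_left (a := (F : Set ℕ)))
    rw [IndepFun_iff_Indep]
    exact indep_of_indep_of_le_left (indep_of_indep_of_le_right h1 hUm.comap_le) hVm.comap_le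
  have hUlaw : P.map U = Measure.pi fun k : F => P.map fun ω (r : ℚ≥0) => L k r ω := by
    have h1 : iIndepFun (fun (k : F) ω (t : ℝ≥0) => L (k : ℕ) t ω) P :=
      hL_indep.precomp Subtype.val_injective
    have h2 : iIndepFun (fun (k : F) ω (r : ℚ≥0) => L (k : ℕ) r ω) P :=
      h1.comp (fun _ f (r : ℚ≥0) => f r) fun _ =>
        measurable_pi_lambda _ fun r => measurable_pi_apply _
    exact (iIndepFun_iff_map_fun_eq_pi_map (ι := F)
      fun k => (hL k).measurable_rat.aemeasurable).1 h2
  set T : Set ((F → ℚ≥0 → ℝ) × (F → ℚ≥0 → ℝ)) :=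
    {p | ∀ k : F, HasSmallModulus (fun r => β k * p.2 k r + p.1 k r) a b η} with hT
  have hTm : MeasurableSet T := by
    rw [hT]
    simp only [Set.ofPred_forall]
    refine MeasurableSet.iInter fun k => ?_
    have hmeas : Measurable fun (p : (F → ℚ≥0 → ℝ) × (F → ℚ≥0 → ℝ)) (r : ℚ≥0) =>
        β k * p.2 k r + p.1 k r := by fun_prop
    exact hmeas (HasSmallModulus.measurableSet_setOf a b η)
  have hset : {ω | ∀ k : F, HasSmallModulus (fun r => β k * L k r ω + R k r ω) a b η} =
      (fun ω => (V ω, U ω)) ⁻¹' T := rfl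
  have hlaw := (indepFun_iff_map_prod_eq_prod_map_map hVm₀.aemeasurable hUm₀.aemeasurable).1 hVU
  have : IsProbabilityMeasure (P.map V) := Measure.isProbabilityMeasure_map hVm₀.aemeasurable
  have hpr : ∀ k : F, IsProbabilityMeasure (P.map fun ω (r : ℚ≥0) => L k r ω) := fun k =>
    Measure.isProbabilityMeasure_map (hL k).measurable_rat.aemeasurable
  rw [hset, ← Measure.map_apply (hVm₀.prodMk hUm₀) hTm, hlaw, Measure.prod_apply hTm]
  have hsec : ∀ v, (P.map U) (Prod.mk v ⁻¹' T) ≤ q ^ F.card := fun v => by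
    have e1 : Prod.mk v ⁻¹' T = Set.univ.pi fun k : F =>
        {u | HasSmallModulus (fun r => β k * u r + v k r) a b η} := by
      ext u
      simp [hT]
    rw [e1, hUlaw, Measure.pi_pi]
    calc _ ≤ ∏ _k : F, q := Finset.prod_le_prod' fun k _ => ?_
      _ = q ^ F.card := by simp
    have hmeas : Measurable fun (u : ℚ≥0 → ℝ) (r : ℚ≥0) => β k * u r + v k r := by fun_prop
    refine (Measure.map_apply (hL k).measurable_rat
      (hmeas (HasSmallModulus.measurableSet_setOf a b η))).trans_le ?_
    exact hq k k.2 (v k)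
  calc _ ≤ ∫⁻ _, q ^ F.card ∂(P.map V) := lintegral_mono hsec
    _ = q ^ F.card := by simp

/-- The threshold `η + η` pays `η` for the coordinate of `X`, dominated by the norm, and `η` for the
continuous term. The finite set `F ⊆ K`, and the decomposition with it, changes with `N`. -/
theorem ae_exists_lt_norm_sub [IsProbabilityMeasure P] [CompleteSpace H]
    (hX : IsStochConvolution P S e β L X) (hL : ∀ n, IsLevyProcess P (L n))
    (hL_indep : iIndepFun (fun n ω (t : ℝ≥0) => L n t ω) P)
    (he : ∀ n, e n ∈ (S.generator†).domain) {K : Set ℕ} (hK : K.Infinite)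
    {a b : ℚ≥0} {η : ℝ} (hη : 0 < η) {q : ℝ≥0∞} (hq1 : q < 1)
    (hq : ∀ k ∈ K, ∀ y : ℚ≥0 → ℝ,
      P {ω | HasSmallModulus (fun r => β k * L k r ω + y r) a b (η + η)} ≤ q) :
    ∀ᵐ ω ∂P, ∃ r ∈ Set.Icc a b, ∃ s ∈ Set.Icc a b, η < ‖X (r : ℚ≥0) ω - X (s : ℚ≥0) ω‖ := by
  have hbound : ∀ N : ℕ, P {ω | ¬ ∃ r ∈ Set.Icc a b, ∃ s ∈ Set.Icc a b,
      η < ‖X (r : ℚ≥0) ω - X (s : ℚ≥0) ω‖} ≤ q ^ N := fun N => by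
    obtain ⟨F, hFK, hF⟩ := hK.exists_subset_card_eq N
    choose R hRm hR using fun k : F => hX.exists_coord_decomposition hL k.2 (he k)
    rw [← hF]
    refine le_trans ?_ (measure_forall_hasSmallModulus_le hL hL_indep F hRm
      fun k hk => hq k (hFK hk))
    refine measure_mono_ae ?_
    filter_upwards [ae_all_iff.2 hR] with ω hω hosc k
    obtain ⟨g, hg, hgX⟩ := hω k
    have h1 : HasSmallModulus (fun r => ⟪X (r : ℚ≥0) ω, e k⟫_ℝ) a b η := by
      refine HasSmallModulus.of_forall fun r hr s hs => ?_
      rw [← inner_sub_left]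
      refine (abs_real_inner_le_norm _ _).trans ?_
      rw [e.orthonormal.1 k, mul_one]
      by_contra hcon
      exact hosc ⟨r, hr, s, hs, not_le.1 hcon⟩
    have h2 := h1.sub (HasSmallModulus.of_continuous hg a b hη)
    simp only [hgX, add_sub_cancel_right] at h2
    exact h2
  have hzero := ge_of_tendsto' (ENNReal.tendsto_pow_atTop_nhds_zero_of_lt_one hq1) hbound
  exact ae_iff.2 (le_antisymm hzero zero_le)

end

/-! ### From oscillation on rational intervals to absence of one-sided limits -/

theorem not_tendsto_of_forall_exists_lt_norm_sub {H : Type*} [NormedAddCommGroup H] {x : ℝ≥0 → H}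
    {η : ℝ} (hη : 0 < η)
    (hosc : ∀ a b : ℚ≥0, a < b → ∃ r ∈ Set.Icc a b, ∃ s ∈ Set.Icc a b,
      η < ‖x (r : ℚ≥0) - x (s : ℚ≥0)‖) {l : Filter ℝ≥0}
    (hl : ∀ A ∈ l, ∃ u v : ℝ≥0, u < v ∧ Set.Ioo u v ⊆ A) (y : H) : ¬ Tendsto x l (𝓝 y) := by
  intro h
  obtain ⟨u, v, huv, hsub⟩ := hl _ (h (Metric.ball_mem_nhds y (half_pos hη)))
  have hrat : ∀ {u v : ℝ≥0}, u < v → ∃ c : ℚ≥0, u < c ∧ (c : ℝ≥0) < v := fun {u v} huv => by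
    obtain ⟨c, h1, h2⟩ := exists_rat_btwn (NNReal.coe_lt_coe.2 huv)
    have hc : (0 : ℚ) ≤ c := by
      have : (0 : ℝ) ≤ c := u.coe_nonneg.trans h1.le
      exact_mod_cast this
    lift c to ℚ≥0 using hc
    exact ⟨c, by rw [← NNReal.coe_lt_coe]; exact_mod_cast h1,
      by rw [← NNReal.coe_lt_coe]; exact_mod_cast h2⟩
  obtain ⟨a, ha1, ha2⟩ := hrat huv
  obtain ⟨b, hb1, hb2⟩ := hrat ha2
  obtain ⟨r, hr, s, hs, hrs⟩ := hosc a b (NNRat.cast_lt.1 hb1)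
  have hin : ∀ q ∈ Set.Icc a b, dist (x (q : ℚ≥0)) y < η / 2 := fun q hq =>
    hsub ⟨ha1.trans_le (NNRat.cast_le.2 hq.1), (NNRat.cast_le.2 hq.2).trans_lt hb2⟩
  have := dist_triangle_right (x r) (x s) y
  rw [dist_eq_norm] at this
  linarith [hin r hr, hin s hs]

theorem theorem2p1
    {Ω : Type*} [MeasurableSpace Ω] (P : Measure Ω) [IsProbabilityMeasure P]
    {H : Type*} [NormedAddCommGroup H] [InnerProductSpace ℝ H] [CompleteSpace H]
    (S : C0Semigroup H) (e : HilbertBasis ℕ ℝ H)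
    (β : ℕ → ℝ) (hβ_pos : ∀ n, 0 < β n)
    (L : ℕ → ℝ≥0 → Ω → ℝ)
    (hL : ∀ n, IsLevyProcess P (L n))
    (hL_indep : iIndepFun (fun n ω (t : ℝ≥0) => L n t ω) P)
    (hL_ident : ∀ n, IdentDistrib (fun ω (t : ℝ≥0) => L n t ω) (fun ω (t : ℝ≥0) => L 0 t ω) P P)
    (hν : ∃ B : Set ℝ, MeasurableSet B ∧ jumpIntensity P (L 0) B ≠ 0)
    (X : ℝ≥0 → Ω → H) (hX : IsStochConvolution P S e β L X)
    (he : ∀ n, e n ∈ (S.generator†).domain)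
    (hβ : ¬ Tendsto β atTop (𝓝 0)) :
    ∀ᵐ ω ∂P,
      (∀ t : ℝ≥0, 0 < t → ¬ ∃ x : H, Tendsto (fun s => X s ω) (𝓝[<] t) (𝓝 x)) ∧
      (∀ t : ℝ≥0, ¬ ∃ x : H, Tendsto (fun s => X s ω) (𝓝[>] t) (𝓝 x)) := by
  obtain ⟨B, -, hB⟩ := hν
  obtain ⟨δ, hδ, hjump⟩ := (hL 0).exists_not_ae_hasSmallModulus hB
  obtain ⟨c, hc, hK⟩ : ∃ c : ℝ, 0 < c ∧ {n | c ≤ β n}.Infinite := by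
    by_contra! hcon
    refine hβ (Metric.tendsto_atTop.2 fun c hc => ?_)
    obtain ⟨N, hN⟩ := (hcon c hc).bddAbove
    refine ⟨N + 1, fun n hn => ?_⟩
    rw [Real.dist_eq, sub_zero, abs_of_pos (hβ_pos n)]
    by_contra hlt
    have := hN (show n ∈ {n | c ≤ β n} from not_lt.1 hlt)
    omega
  -- Chosen so that `η + η = c * δ / 4 ≤ β k * (δ / 4)`: dividing by `β k` reaches the
  -- symmetrization threshold.
  set η : ℝ := c * δ / 8 with hηdef
  have hη : 0 < η := by positivity
  have hosc : ∀ᵐ ω ∂P, ∀ a b : ℚ≥0, a < b → ∃ r ∈ Set.Icc a b, ∃ s ∈ Set.Icc a b,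
      η < ‖X (r : ℚ≥0) ω - X (s : ℚ≥0) ω‖ := by
    refine ae_all_iff.2 fun a => ae_all_iff.2 fun b => ?_
    by_cases hab : a < b
    swap
    · exact Eventually.of_forall fun ω h => absurd h hab
    obtain ⟨q, hq1, hq⟩ := (hL 0).exists_bound_shift_hasSmallModulus hδ hjump hab
    refine (ae_exists_lt_norm_sub hX hL hL_indep he hK hη hq1 fun k hk y => ?_).mono
      fun ω hω _ => hω
    have hβk := hβ_pos k
    have hsub : {ω | HasSmallModulus (fun r => β k * L k r ω + y r) a b (η + η)} ⊆
        {ω | HasSmallModulus (fun r => L k r ω + (β k)⁻¹ * y r) a b (δ / 4)} := by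
      intro ω hω
      have h1 := (HasSmallModulus.const_mul hω (β k)⁻¹).mono_right (δ' := δ / 4) (by
        rw [abs_of_pos (inv_pos.2 hβk), inv_mul_le_iff₀ hβk, hηdef]
        have := mul_le_mul_of_nonneg_right (show c ≤ β k from hk) hδ.le
        linarith)
      show HasSmallModulus (fun r => L k r ω + (β k)⁻¹ * y r) a b (δ / 4)
      simpa only [mul_add, inv_mul_cancel_left₀ hβk.ne'] using h1
    -- Equality of path laws transfers the bound from `L 0` to `L k`, so one `q` serves all `k`.
    refine (measure_mono hsub).trans (le_of_eq_of_le ?_ (hq fun r => (β k)⁻¹ * y r))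
    have hmeas : Measurable fun (f : ℝ≥0 → ℝ) (r : ℚ≥0) => f r + (β k)⁻¹ * y r :=
      measurable_pi_lambda _ fun r => (measurable_pi_apply (r : ℝ≥0)).add_const _
    exact (hL_ident k).measure_mem_eq (hmeas (HasSmallModulus.measurableSet_setOf a b (δ / 4)))
  filter_upwards [hosc] with ω hω
  refine ⟨fun t ht => ?_, fun t => ?_⟩
  · rintro ⟨x, hx⟩
    refine not_tendsto_of_forall_exists_lt_norm_sub hη hω (fun A hA => ?_) x hx
    obtain ⟨u, hu, hsub⟩ := (mem_nhdsLT_iff_exists_Ioo_subset' ht).1 hA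
    exact ⟨u, t, hu, hsub⟩
  · rintro ⟨x, hx⟩
    refine not_tendsto_of_forall_exists_lt_norm_sub hη hω (fun A hA => ?_) x hx
    obtain ⟨u, hu, hsub⟩ := mem_nhdsGT_iff_exists_Ioo_subset.1 hA
    exact ⟨t, u, hu, hsub⟩
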